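/- Let $G$ be a three-dimensional Lie group with a bi-invariant metric $\langle\,,\rangle$ and Lie algebra $\mathfrak g=T_eG$, oriented. Vector fields along a curve in $G$ are written in a left-invariant basis, i.e. regarded as $\mathfrak g$-valued functions; $\dot W$ is the componentwise derivative and $D_TW=\dot W+\frac12[T,W]$ is the covariant derivative along a curve with velocity $T$. For a smooth unit speed curve on an open interval with Frenet apparatus $(T,N,B,\kappa,\tau)$, $\kappa>0$, $B=T\times N$, where $D_TT=\kappa N$, $D_TN=-\kappa T+\tau B$, $D_TB=-\tau N$, put $\tau_G=\frac12\langle[T,N],B\rangle$ and $H=(\tau-\tau_G)/\kappa$; then $\dot T=\kappa N$, $\dot N=-\kappa T+(\tau-\tau_G)B$, $\dot B=-(\tau-\tau_G)N$. A development of the curve is a curve $A$ in the Euclidean space $\mathfrak g$ with $\dot A=T$ (unique up to translation). Let $(\alpha,\tilde\alpha)$ be a Bertrand curve pair in $G$ with arc length parameters $s\in I$ and $s^*\in J$ ($I,J$ open intervals), with correspondence a differentiable bijection $s\mapsto s^*(s)$ from $I$ onto $J$, $ds^*/ds>0$, and Frenet apparatus $(T,N,B,\kappa,\tau)$ and $(\tilde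 T,\tilde N,\tilde B,\tilde\kappa,\tilde\tau)$. That is: $\alpha$ and $\tilde\alpha$ have developments which are different curves and which at corresponding points have the same principal normal lines (the lines through these points in the directions $N$, $\tilde N$). Let $'$ denote $d/ds^*$, suppose $\tilde\kappa'\ne0$ and $\tilde H\neq 0$ on $J$, and let $$\rho=\frac{(\tilde\tau-\tilde\tau_G)'}{\tilde\kappa'},\qquad \Delta=\tilde\kappa'^2(\tilde H-\rho)^2+\tilde\kappa^4(1+\tilde H^2)^3 .$$ Then $\rho-\tilde H\ne0$ everywhere, there is a constant $\epsilon\in\{1,-1\}$ with $N(s)=\epsilon\tilde N(s^*(s))$ for all $s\in I$, and the principal normal indicatrix $\alpha_n=N=\epsilon\tilde N$, a curve in the unit sphere of $\mathfrak g$, is regular. For every $s_0\in I$, $$s_n(s)=\int_{s_0}^{s}\frac{\tilde\kappa\,|\rho-\tilde H|\sqrt{1+\tilde H^2}}{|\tilde H|\sqrt{1+\rho^2}}\,ds$$ (with $\tilde\kappa,\tilde H,\rho$ evaluated at $s^*(s)$) is an arc length parameter of $\alpha_n$, and the Frenet apparatus of $\alpha_n$, i.e. the positively oriented orthonormal frame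 $(T_n,N_n,B_n)$ and the functions $\kappa_n>0$, $(\tau-\tau_G)_n$ with $$\frac{d\alpha_n}{ds_n}=T_n,\quad \frac{dT_n}{ds_n}=\kappa_nN_n,\quad \frac{dN_n}{ds_n}=-\kappa_nT_n+(\tau-\tau_G)_nB_n,\quad \frac{dB_n}{ds_n}=-(\tau-\tau_G)_nN_n,$$ is, all quantities on the right being evaluated at $s^*(s)$, $$T_n=\frac{-\epsilon\{\tilde T-\tilde H\tilde B\}}{\sqrt{1+\tilde H^2}},\qquad N_n=\frac{\epsilon\{\tilde H\tilde\kappa'(\rho-\tilde H)\tilde T-\tilde\kappa^2(1+\tilde H^2)^2\tilde N-\tilde\kappa'(\tilde H-\rho)\tilde B\}}{\sqrt{\Delta}\,\sqrt{1+\tilde H^2}},$$ $$B_n=\frac{\tilde\kappa^2\tilde H(1+\tilde H^2)\tilde T+\tilde\kappa'(\rho-\tilde H)\tilde N+\tilde\kappa^2(1+\tilde H^2)\tilde B}{\sqrt\Delta},\qquad \kappa_n=\frac{\sqrt\Delta}{\tilde\kappa^2(1+\tilde H^2)^{3/2}},$$ $$(\tau-\tau_G)_n=\frac{\epsilon(\tilde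 H-\rho)\left[(3\tilde\kappa'^2-\tilde\kappa''\tilde\kappa)(1+\tilde H^2)-3\tilde\kappa'^2\tilde H(\tilde H-\rho)\right]}{\Delta}.$$ -/

import Mathlib

open Set Manifold
open scoped ContDiff

noncomputable section

section LieGroupCurves

variable {G : Type*} [TopologicalSpace G] [ChartedSpace (EuclideanSpace ℝ (Fin 3)) G] [Group G]
  [LieGroup (𝓡 3) ∞ G]

variable (G) in
/-- A bi-invariant Riemannian metric on a three-dimensional Lie group: a smooth Riemannian metric
for which all left translations and all right translations are isometries. -/
structure BiInvariantMetric where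
  /-- the underlying smooth Riemannian metric -/
  toMetric : Bundle.ContMDiffRiemannianMetric (𝓡 3) ∞ (EuclideanSpace ℝ (Fin 3))
    (TangentSpace (𝓡 3) : G → Type)
  left_invariant : ∀ (a x : G) (v w : TangentSpace (𝓡 3) x),
    toMetric.inner (a * x) (mfderiv (𝓡 3) (𝓡 3) (fun y : G => a * y) x v)
      (mfderiv (𝓡 3) (𝓡 3) (fun y : G => a * y) x w) = toMetric.inner x v w
  right_invariant : ∀ (a x : G) (v w : TangentSpace (𝓡 3) x),
    toMetric.inner (x * a) (mfderiv (𝓡 3) (𝓡 3) (fun y : G => y * a) x v)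
      (mfderiv (𝓡 3) (𝓡 3) (fun y : G => y * a) x w) = toMetric.inner x v w

/-- The inner product on the Lie algebra `T₁G` given by the metric. -/
def BiInvariantMetric.dot (m : BiInvariantMetric G) (v w : GroupLieAlgebra (𝓡 3) G) : ℝ :=
  m.toMetric.inner 1 v w

/-- The velocity of a curve in `G`, translated back to the Lie algebra by left translation.
Vector fields along a curve are throughout identified in this way with functions into the Lie
algebra, that is, they are written in a basis of left-invariant fields. -/
def leftVelocity (α : ℝ → G) (s : ℝ) : GroupLieAlgebra (𝓡 3) G :=
  (mfderiv (𝓡 3) (𝓡 3) (fun x : G => (α s)⁻¹ * x) (α s)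
    (mfderiv 𝓘(ℝ, ℝ) (𝓡 3) α s (1 : ℝ)) : EuclideanSpace ℝ (Fin 3))

/-- The covariant derivative `D_{α'} W = Ẇ + ½ [T, W]` along a curve with velocity `T`, for the
Levi-Civita connection of a bi-invariant metric; `Ẇ` is the derivative of the components of `W`
in a left-invariant basis. -/
def covDerivAlong (T W : ℝ → GroupLieAlgebra (𝓡 3) G) (s : ℝ) : GroupLieAlgebra (𝓡 3) G :=
  deriv W s + (1 / 2 : ℝ) • ⁅T s, W s⁆

/-- `(T, N, B)` is a positively oriented orthonormal frame of the Lie algebra, that is, an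
orthonormal frame with `B = T × N`. -/
structure IsPositiveFrame (m : BiInvariantMetric G)
    (o : Orientation ℝ (GroupLieAlgebra (𝓡 3) G) (Fin 3))
    (T N B : GroupLieAlgebra (𝓡 3) G) : Prop where
  dot_TT : m.dot T T = 1
  dot_NN : m.dot N N = 1
  dot_BB : m.dot B B = 1
  dot_TN : m.dot T N = 0
  dot_TB : m.dot T B = 0
  dot_NB : m.dot N B = 0
  oriented : ∃ b : Module.Basis (Fin 3) ℝ (GroupLieAlgebra (𝓡 3) G),
    (∀ i, b i = ![T, N, B] i) ∧ b.orientation = o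

/-- The components of a vector field along a curve are smooth on `I`. -/
def IsSmoothField (m : BiInvariantMetric G) (I : Set ℝ)
    (W : ℝ → GroupLieAlgebra (𝓡 3) G) : Prop :=
  ∀ X : GroupLieAlgebra (𝓡 3) G, ContDiffOn ℝ ∞ (fun s => m.dot X (W s)) I

/-- `α` is a smooth curve in `G` on the open interval `I`, parametrized by arc length, and
`(T, N, B, κ, τ)` is its Frenet apparatus. -/
structure IsFrenetApparatus (m : BiInvariantMetric G)
    (o : Orientation ℝ (GroupLieAlgebra (𝓡 3) G) (Fin 3)) (I : Set ℝ) (α : ℝ → G)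
    (T N B : ℝ → GroupLieAlgebra (𝓡 3) G) (κ τ : ℝ → ℝ) : Prop where
  smooth_curve : ContMDiffOn 𝓘(ℝ, ℝ) (𝓡 3) ∞ α I
  smooth_T : IsSmoothField m I T
  smooth_N : IsSmoothField m I N
  smooth_B : IsSmoothField m I B
  smooth_κ : ContDiffOn ℝ ∞ κ I
  smooth_τ : ContDiffOn ℝ ∞ τ I
  velocity : ∀ s ∈ I, T s = leftVelocity α s
  frame : ∀ s ∈ I, IsPositiveFrame m o (T s) (N s) (B s)
  curvature_pos : ∀ s ∈ I, 0 < κ s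
  frenet_T : ∀ s ∈ I, covDerivAlong T T s = κ s • N s
  frenet_N : ∀ s ∈ I, covDerivAlong T N s = -(κ s) • T s + τ s • B s
  frenet_B : ∀ s ∈ I, covDerivAlong T B s = -(τ s) • N s

/-- The group torsion `τ_G = ½ ⟨[T, N], B⟩`. -/
def groupTorsion (m : BiInvariantMetric G) (T N B : ℝ → GroupLieAlgebra (𝓡 3) G) (s : ℝ) : ℝ :=
  1 / 2 * m.dot ⁅T s, N s⁆ (B s)

/-- The modified torsion `τ - τ_G`. -/
def modifiedTorsion (m : BiInvariantMetric G) (T N B : ℝ → GroupLieAlgebra (𝓡 3) G)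
    (τ : ℝ → ℝ) (s : ℝ) : ℝ :=
  τ s - groupTorsion m T N B s

/-- The harmonic curvature `H = (τ - τ_G) / κ`. -/
def harmonicCurvature (m : BiInvariantMetric G) (T N B : ℝ → GroupLieAlgebra (𝓡 3) G)
    (κ τ : ℝ → ℝ) (s : ℝ) : ℝ :=
  modifiedTorsion m T N B τ s / κ s

/-- `A` is a development of the curve `α` in the Lie algebra: the curve in the Euclidean space
`T₁G`, unique up to a translation, whose velocity is the left-translated velocity of `α`. It is
through developments that a sum such as `α + λ N` of a point of `G` and a vector of the Lie algebra
is given a meaning. If `G` is a Euclidean space, `A` is `α` up to a translation. -/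
def IsDevelopment (I : Set ℝ) (α : ℝ → G) (A : ℝ → GroupLieAlgebra (𝓡 3) G) : Prop :=
  ∀ s ∈ I, HasDerivAt A (leftVelocity α s) s

/-- The line through `p` with direction `v`. -/
def lineThrough (p v : GroupLieAlgebra (𝓡 3) G) : Set (GroupLieAlgebra (𝓡 3) G) :=
  Set.range (fun r : ℝ => p + r • v)

/-- The curves `α` (on `I`, with principal normal `N`) and `α'` (on `J`, with principal
normal `N'`) are a Bertrand pair, where the point with parameter `s` on `α` corresponds to the point
with parameter `ψ s` on `α'`: their developments, suitably placed, are different curves with the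
same principal normal lines at corresponding points. -/
structure IsBertrandPair (I J : Set ℝ) (α α' : ℝ → G)
    (N N' : ℝ → GroupLieAlgebra (𝓡 3) G) (ψ : ℝ → ℝ) : Prop where
  bijOn : BijOn ψ I J
  differentiable : ∀ s ∈ I, DifferentiableAt ℝ ψ s
  deriv_pos : ∀ s ∈ I, 0 < deriv ψ s
  normal_lines : ∃ A A' : ℝ → GroupLieAlgebra (𝓡 3) G,
    IsDevelopment I α A ∧ IsDevelopment J α' A' ∧
    (∀ s ∈ I, lineThrough (A s) (N s) = lineThrough (A' (ψ s)) (N' (ψ s))) ∧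
    ∃ s ∈ I, A s ≠ A' (ψ s)

/-- `γ` is a regular curve in the Lie algebra on the open interval `I`, `σ` is an arc length
parameter of it (as a function of the given parameter), and `(T, N, B, κ, h)` is its Frenet
apparatus: `dγ/dσ = T`, `dT/dσ = κ N`, `dN/dσ = -κ T + h B`, `dB/dσ = -h N`. Here `h` is the
modified torsion, since the derivative of components is `Ẇ = D_T W - ½ [T, W]`. -/
structure IsIndicatrixFrenetApparatus (m : BiInvariantMetric G)
    (o : Orientation ℝ (GroupLieAlgebra (𝓡 3) G) (Fin 3)) (I : Set ℝ)
    (γ : ℝ → GroupLieAlgebra (𝓡 3) G) (σ : ℝ → ℝ)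
    (T N B : ℝ → GroupLieAlgebra (𝓡 3) G) (κ h : ℝ → ℝ) : Prop where
  differentiable : ∀ s ∈ I, DifferentiableAt ℝ γ s
  regular : ∀ s ∈ I, 0 < m.dot (deriv γ s) (deriv γ s)
  arcLength : ∀ s ∈ I, HasDerivAt σ (√(m.dot (deriv γ s) (deriv γ s))) s
  frame : ∀ s ∈ I, IsPositiveFrame m o (T s) (N s) (B s)
  curvature_pos : ∀ s ∈ I, 0 < κ s
  tangent : ∀ s ∈ I, HasDerivAt γ (deriv σ s • T s) s
  frenet_T : ∀ s ∈ I, HasDerivAt T (deriv σ s • (κ s • N s)) s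
  frenet_N : ∀ s ∈ I, HasDerivAt N (deriv σ s • (-(κ s) • T s + h s • B s)) s
  frenet_B : ∀ s ∈ I, HasDerivAt B (deriv σ s • (-(h s) • N s)) s

end LieGroupCurves

end

/-! In left-invariant components the bracket term of the connection only replaces `τ` by `τ - τ_G`,
so everything reduces to Frenet curves in a three-dimensional Euclidean space. That space is
modelled by a normed space `E`, whose norm merely supplies the topology, with a separate symmetric
form `g`. Dimension three enters through the expansion of vectors in a frame.

For a Bertrand pair, the segment joining corresponding points of the developments is a constant
multiple of the common normal, and the two tangents make a constant angle
(`exists_bertrand_constants`). Differentiating the segment shows that, for constants `c`, `d` and `μ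
≠ 0`, the mate satisfies `ψ' (1 + μ κ) = c` and `-μ ψ' h = d`. Eliminating `ψ'` gives a linear
relation `h = r κ + ν` with `ν ≠ 0` (`exists_curvature_relation`). Hence `ρ = r` is constant, `ρ - H
= -ν / κ` never vanishes, and `H' = κ' (ρ - H) / κ`. The same constants express `ψ'` by `H` and `ρ`,
which turns the speed `ψ' κ √(1 + H²)` of the indicatrix into the stated integrand.

The rest is computation on the mate alone: the proposed frame is orthonormal and oriented, its
tangent has the right derivative, and one pairing `⟨B', N⟩` gives the torsion. Orthonormality forces
the remaining Frenet equations (`frenet_of_frame`). -/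

noncomputable section

/-! ### Frenet curves for a bilinear form, and the constants of a Bertrand pair. -/

section FrenetCurves

open Topology

variable {E : Type*} [NormedAddCommGroup E] [NormedSpace ℝ E] (g : E →L[ℝ] E →L[ℝ] ℝ)

/-- `(T, N, B)` is an orthonormal frame for the bilinear form `g`. -/
structure IsOrthonormalFrame (T N B : E) : Prop where
  TT : g T T = 1
  NN : g N N = 1
  BB : g B B = 1
  TN : g T N = 0
  TB : g T B = 0
  NB : g N B = 0
  expansion : ∀ x, x = g x T • T + g x N • N + g x B • B

/-- A moving orthonormal frame satisfying Frenet equations with coefficients `κ` and `h`. -/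
structure IsFrenetCurve (I : Set ℝ) (T N B : ℝ → E) (κ h : ℝ → ℝ) : Prop where
  frame : ∀ s ∈ I, IsOrthonormalFrame g (T s) (N s) (B s)
  hasDerivAt_T : ∀ s ∈ I, HasDerivAt T (κ s • N s) s
  hasDerivAt_N : ∀ s ∈ I, HasDerivAt N (-(κ s) • T s + h s • B s) s
  hasDerivAt_B : ∀ s ∈ I, HasDerivAt B (-(h s) • N s) s

variable {g}

theorem hasDerivAt_form {X Y : ℝ → E} {X' Y' : E} {s : ℝ} (hX : HasDerivAt X X' s)
    (hY : HasDerivAt Y Y' s) :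
    HasDerivAt (fun u => g (X u) (Y u)) (g X' (Y s) + g (X s) Y') s := by
  rw [add_comm]
  exact g.hasDerivAt_of_bilinear (fun _ => hX) (fun _ => hY)

theorem form_deriv_add_eq_zero {X Y : ℝ → E} {X' Y' : E} {s c : ℝ} (hX : HasDerivAt X X' s)
    (hY : HasDerivAt Y Y' s) (hc : ∀ᶠ u in 𝓝 s, g (X u) (Y u) = c) :
    g X' (Y s) + g (X s) Y' = 0 :=
  (hasDerivAt_form hX hY).unique
    ((hasDerivAt_const s c).congr_of_eventuallyEq hc)

theorem exists_eq_const_of_hasDerivAt_zero {I : Set ℝ} (hI : IsOpen I) (hc : I.OrdConnected)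
    {f : ℝ → ℝ} (hf : ∀ s ∈ I, HasDerivAt f 0 s) : ∃ a, ∀ s ∈ I, f s = a :=
  hI.exists_is_const_of_deriv_eq_zero hc.isPreconnected
    (fun s hs => (hf s hs).differentiableAt.differentiableWithinAt)
    (fun s hs => (hf s hs).deriv)

/-- The Frenet equations for `N` and `B` follow from the one for `T`, orthonormality and the
knowledge of `⟨B', N⟩`. -/
theorem frenet_of_frame (hg : ∀ x y, g x y = g y x) {T N B : ℝ → E} {N' B' : E} {s k τ : ℝ}
    (hf : ∀ᶠ u in 𝓝 s, IsOrthonormalFrame g (T u) (N u) (B u))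
    (hT : HasDerivAt T (k • N s) s) (hN : HasDerivAt N N' s) (hB : HasDerivAt B B' s)
    (hτ : g B' (N s) = -τ) :
    N' = -k • T s + τ • B s ∧ B' = -τ • N s := by
  have h0 := hf.self_of_nhds
  have e1 := form_deriv_add_eq_zero hN hN (hf.mono fun u hu => hu.NN)
  have e2 := form_deriv_add_eq_zero hB hB (hf.mono fun u hu => hu.BB)
  have e3 := form_deriv_add_eq_zero hT hN (hf.mono fun u hu => hu.TN)
  have e4 := form_deriv_add_eq_zero hT hB (hf.mono fun u hu => hu.TB)
  have e5 := form_deriv_add_eq_zero hN hB (hf.mono fun u hu => hu.NB)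
  simp only [map_smul, _root_.smul_apply, smul_eq_mul, h0.NN, h0.NB] at e3 e4
  rw [hg (N s) N'] at e1
  rw [hg (B s) B'] at e2
  rw [hg (T s) N'] at e3
  rw [hg (T s) B'] at e4
  rw [hg (N s) B'] at e5
  constructor
  · rw [h0.expansion N', show g N' (T s) = -k by linarith, show g N' (N s) = 0 by linarith,
      show g N' (B s) = τ by linarith]
    simp
  · rw [h0.expansion B', show g B' (T s) = 0 by linarith, show g B' (B s) = 0 by linarith, hτ]
    simp

namespace IsOrthonormalFrame

variable {T N B : E}

theorem form_comb (hg : ∀ x y, g x y = g y x) (h : IsOrthonormalFrame g T N B)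
    (a b c a' b' c' : ℝ) :
    g (a • T + b • N + c • B) (a' • T + b' • N + c' • B) = a * a' + b * b' + c * c' := by
  have h1 : g N T = 0 := by rw [hg, h.TN]
  have h2 : g B T = 0 := by rw [hg, h.TB]
  have h3 : g B N = 0 := by rw [hg, h.NB]
  simp only [map_add, map_smul, _root_.add_apply, _root_.smul_apply,
    smul_eq_mul, h.TT, h.NN, h.BB, h.TN, h.TB, h.NB, h1, h2, h3]
  ring

end IsOrthonormalFrame

namespace IsFrenetCurve

variable {I : Set ℝ} {T N B : ℝ → E} {κ h : ℝ → ℝ}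

theorem hasDerivAt_comb (hc : IsFrenetCurve g I T N B κ h) {s : ℝ} (hs : s ∈ I)
    {a b c : ℝ → ℝ} {a' b' c' : ℝ} (ha : HasDerivAt a a' s) (hb : HasDerivAt b b' s)
    (hc' : HasDerivAt c c' s) :
    HasDerivAt (fun u => a u • T u + b u • N u + c u • B u)
      ((a' - κ s * b s) • T s + (b' + κ s * a s - h s * c s) • N s + (c' + h s * b s) • B s) s := by
  refine (((ha.smul (hc.hasDerivAt_T s hs)).add (hb.smul (hc.hasDerivAt_N s hs))).add
    (hc'.smul (hc.hasDerivAt_B s hs))).congr_deriv ?_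
  module

end IsFrenetCurve

/-- Unit vectors spanning the same line, together with the relation between the base points. -/
theorem exists_of_range_line_eq {p q v w : E} (hv : g v v = 1) (hw : g w w = 1)
    (h : Set.range (fun r : ℝ => p + r • v) = Set.range (fun r : ℝ => q + r • w)) :
    (∃ r : ℝ, q - p = r • v) ∧ ∃ e : ℝ, e ^ 2 = 1 ∧ v = e • w := by
  -- The points `q` and `q + w` of the second line both lie on the first; their difference makes `w`
  -- a multiple of `v`.
  obtain ⟨r, hr⟩ : q ∈ Set.range (fun r : ℝ => p + r • v) := h ▸ ⟨0, by simp⟩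
  obtain ⟨r', hr'⟩ : q + (1 : ℝ) • w ∈ Set.range (fun r : ℝ => p + r • v) := h ▸ ⟨1, rfl⟩
  simp only at hr hr'
  have hwv : w = (r' - r) • v := by
    have : w = (p + r' • v) - (p + r • v) := by rw [hr', hr]; simp
    rw [this]; module
  have he : (r' - r) ^ 2 = 1 := by
    rw [hwv] at hw
    simp only [map_smul, _root_.smul_apply, smul_eq_mul, hv] at hw
    linarith
  refine ⟨⟨r, by rw [← hr]; simp⟩, r' - r, he, ?_⟩
  rw [hwv, smul_smul, ← pow_two, he, one_smul]

/-- For a pair of Frenet curves with common principal normal lines the tangents make a constant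
angle, which amounts to the relations below with constants `μ ≠ 0`, `c`, `d`. -/
theorem exists_bertrand_constants (hg : ∀ x y, g x y = g y x) {I J : Set ℝ} (hI : IsOpen I)
    (hIc : I.OrdConnected) {T N B Tt Nt Bt A At : ℝ → E} {κ h κt ht ψ : ℝ → ℝ}
    (hα : IsFrenetCurve g I T N B κ h) (hαt : IsFrenetCurve g J Tt Nt Bt κt ht)
    (hA : ∀ s ∈ I, HasDerivAt A (T s) s) (hAt : ∀ t ∈ J, HasDerivAt At (Tt t) t)
    (hmaps : MapsTo ψ I J) (hψ : ∀ s ∈ I, DifferentiableAt ℝ ψ s)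
    (hline : ∀ s ∈ I, Set.range (fun r : ℝ => A s + r • N s) =
      Set.range (fun r : ℝ => At (ψ s) + r • Nt (ψ s)))
    (hne : ∃ s ∈ I, A s ≠ At (ψ s)) :
    ∃ ε : ℝ, (ε = 1 ∨ ε = -1) ∧ (∀ s ∈ I, N s = ε • Nt (ψ s)) ∧
      ∃ μ c d : ℝ, μ ≠ 0 ∧ c ^ 2 + d ^ 2 = 1 ∧
        (∀ s ∈ I, deriv ψ s * (1 + μ * κt (ψ s)) = c) ∧
        ∀ s ∈ I, -(μ * deriv ψ s * ht (ψ s)) = d := by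
  have key := fun s hs => exists_of_range_line_eq (hα.frame s hs).NN
    (hαt.frame _ (hmaps hs)).NN (hline s hs)
  have hψd := fun s hs => (hψ s hs).hasDerivAt
  have hTt : ∀ s ∈ I, HasDerivAt (fun u => Tt (ψ u)) _ s := fun s hs =>
    (hαt.hasDerivAt_T _ (hmaps hs)).scomp s (hψd s hs)
  have hNt : ∀ s ∈ I, HasDerivAt (fun u => Nt (ψ u)) _ s := fun s hs =>
    (hαt.hasDerivAt_N _ (hmaps hs)).scomp s (hψd s hs)
  have hBt : ∀ s ∈ I, HasDerivAt (fun u => Bt (ψ u)) _ s := fun s hs =>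
    (hαt.hasDerivAt_B _ (hmaps hs)).scomp s (hψd s hs)
  have hAt' : ∀ s ∈ I, HasDerivAt (fun u => At (ψ u)) _ s := fun s hs =>
    (hAt _ (hmaps hs)).scomp s (hψd s hs)
  -- orthogonality to both normals
  have horthN : ∀ s ∈ I, ∀ x, g x (Nt (ψ s)) = 0 → g x (N s) = 0 := by
    intro s hs x hx
    obtain ⟨e, -, h2⟩ := (key s hs).2
    rw [h2, map_smul, hx, smul_zero]
  have horthNt : ∀ s ∈ I, ∀ x, g x (N s) = 0 → g x (Nt (ψ s)) = 0 := by
    intro s hs x hx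
    obtain ⟨e, h1, h2⟩ := (key s hs).2
    rw [h2, map_smul, smul_eq_mul] at hx
    rcases mul_eq_zero.1 hx with h | h
    · simp [h] at h1
    · exact h
  -- the constant sign
  obtain ⟨ε, hε⟩ : ∃ ε, ∀ s ∈ I, g (N s) (Nt (ψ s)) = ε := by
    -- The derivative of each normal is orthogonal to that normal, hence to the other one, which is
    -- parallel to it. The pairing is therefore constant, with no continuity argument for the
    -- pointwise signs.
    refine exists_eq_const_of_hasDerivAt_zero hI hIc fun s hs => ?_
    refine (hasDerivAt_form (hα.hasDerivAt_N s hs) (hNt s hs)).congr_deriv ?_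
    have f := hα.frame s hs
    have ft := hαt.frame _ (hmaps hs)
    have e1 : g (-(κ s) • T s + h s • B s) (Nt (ψ s)) = 0 := by
      refine horthNt s hs _ ?_
      simp [f.TN, hg (B s) (N s), f.NB]
    have e2 : g (-(κt (ψ s)) • Tt (ψ s) + ht (ψ s) • Bt (ψ s)) (N s) = 0 := by
      refine horthN s hs _ ?_
      simp [ft.TN, hg (Bt (ψ s)) (Nt (ψ s)), ft.NB]
    rw [e1, map_smul, hg (N s), e2, smul_zero, add_zero]
  have hNε : ∀ s ∈ I, ε ^ 2 = 1 ∧ N s = ε • Nt (ψ s) := by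
    intro s hs
    obtain ⟨e, h1, h2⟩ := (key s hs).2
    have : ε = e := by
      rw [← hε s hs, h2, map_smul, _root_.smul_apply,
        (hαt.frame _ (hmaps hs)).NN, smul_eq_mul, mul_one]
    exact this ▸ ⟨h1, h2⟩
  obtain ⟨s₁, hs₁, hs₁ne⟩ := hne
  have hε2 := (hNε s₁ hs₁).1
  -- the constant distance
  have hT0 : ∀ s ∈ I, g (Tt (ψ s)) (N s) = 0 := fun s hs =>
    horthN s hs _ (hαt.frame _ (hmaps hs)).TN
  obtain ⟨l, hl⟩ : ∃ l, ∀ s ∈ I, g (At (ψ s) - A s) (N s) = l := by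
    refine exists_eq_const_of_hasDerivAt_zero hI hIc fun s hs => ?_
    refine (hasDerivAt_form ((hAt' s hs).sub (hA s hs)) (hα.hasDerivAt_N s hs)).congr_deriv ?_
    -- Both tangents are orthogonal to `N`, and the segment is parallel to `N` while `N'` is
    -- orthogonal to it, so both terms vanish.
    obtain ⟨r, hr⟩ := (key s hs).1
    have f := hα.frame s hs
    rw [Pi.sub_apply, hr]
    simp [hT0 s hs, f.TN, f.NB, hg (N s) (T s)]
  have hAl : ∀ s ∈ I, At (ψ s) - A s = l • N s := by
    intro s hs
    obtain ⟨r, hr⟩ := (key s hs).1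
    have := hl s hs
    rw [hr, map_smul, _root_.smul_apply, (hα.frame s hs).NN, smul_eq_mul,
      mul_one] at this
    rw [hr, this]
  have hl0 : l ≠ 0 := by
    rintro rfl
    refine hs₁ne ?_
    have := hAl s₁ hs₁
    rw [zero_smul, sub_eq_zero] at this
    exact this.symm
  -- Obtained by differentiating `At ∘ ψ - A = l ε (Nt ∘ ψ)` and comparing both sides.
  have hTeq : ∀ s ∈ I, T s = (deriv ψ s * (1 + l * ε * κt (ψ s))) • Tt (ψ s) +
      (0 : ℝ) • Nt (ψ s) + (-(l * ε * deriv ψ s * ht (ψ s))) • Bt (ψ s) := by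
    intro s hs
    have h1 : HasDerivAt (fun u => At (ψ u) - A u) _ s := (hAt' s hs).sub (hA s hs)
    have h2 : HasDerivAt (fun u => At (ψ u) - A u) _ s :=
      (((hNt s hs).const_smul ε).const_smul l).congr_of_eventuallyEq (by
        filter_upwards [hI.mem_nhds hs] with u hu
        rw [hAl u hu, (hNε u hu).2]; rfl)
    have h3 := h1.unique h2
    rw [sub_eq_iff_eq_add, ← sub_eq_iff_eq_add'] at h3
    rw [← h3]
    module
  have hTc : ∀ s ∈ I, g (T s) (Tt (ψ s)) = deriv ψ s * (1 + l * ε * κt (ψ s)) := by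
    intro s hs
    have := (hαt.frame _ (hmaps hs)).form_comb hg (deriv ψ s * (1 + l * ε * κt (ψ s))) 0
      (-(l * ε * deriv ψ s * ht (ψ s))) 1 0 0
    rw [← hTeq s hs] at this
    simpa using this
  have hTd : ∀ s ∈ I, g (T s) (Bt (ψ s)) = -(l * ε * deriv ψ s * ht (ψ s)) := by
    intro s hs
    have := (hαt.frame _ (hmaps hs)).form_comb hg (deriv ψ s * (1 + l * ε * κt (ψ s))) 0
      (-(l * ε * deriv ψ s * ht (ψ s))) 0 0 1
    rw [← hTeq s hs] at this
    simpa using this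
  have hNT : ∀ s ∈ I, g (N s) (Tt (ψ s)) = 0 := fun s hs => by rw [hg, hT0 s hs]
  have hNB : ∀ s ∈ I, g (N s) (Bt (ψ s)) = 0 := fun s hs => by
    rw [hg, horthN s hs]
    rw [hg, (hαt.frame _ (hmaps hs)).NB]
  have hTN : ∀ s ∈ I, g (T s) (Nt (ψ s)) = 0 := fun s hs =>
    horthNt s hs _ (hα.frame s hs).TN
  -- Each tangent has its derivative along the common normal, which is orthogonal to the other
  -- tangent and to `Bt`; the same reason covers `d` below.
  obtain ⟨c, hc⟩ : ∃ c, ∀ s ∈ I, g (T s) (Tt (ψ s)) = c := by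
    refine exists_eq_const_of_hasDerivAt_zero hI hIc fun s hs => ?_
    refine (hasDerivAt_form (hα.hasDerivAt_T s hs) (hTt s hs)).congr_deriv ?_
    simp [hNT s hs, hTN s hs]
  obtain ⟨d, hd⟩ : ∃ d, ∀ s ∈ I, g (T s) (Bt (ψ s)) = d := by
    refine exists_eq_const_of_hasDerivAt_zero hI hIc fun s hs => ?_
    refine (hasDerivAt_form (hα.hasDerivAt_T s hs) (hBt s hs)).congr_deriv ?_
    simp [hNB s hs, hTN s hs]
  refine ⟨ε, sq_eq_sq_iff_eq_or_eq_neg.1 (by simpa using hε2), fun s hs => (hNε s hs).2, l * ε, c, d,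
    mul_ne_zero hl0 ?_, ?_, fun s hs => by rw [← hTc s hs, hc s hs],
    fun s hs => by rw [← hTd s hs, hd s hs]⟩
  · rintro rfl; simp at hε2
  · have := (hαt.frame _ (hmaps hs₁)).form_comb hg c 0 d c 0 d
    have h2 := hTeq s₁ hs₁
    rw [← hTc s₁ hs₁, ← hTd s₁ hs₁, hc s₁ hs₁, hd s₁ hs₁] at h2
    rw [← h2, (hα.frame s₁ hs₁).TT] at this
    linarith

end FrenetCurves

/-! ### The linear curvature relation and the Frenet equations of the indicatrix. -/

section PrincipalNormalIndicatrix

open Topology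

/-- The relation `h = r κ + ν` between the curvatures of a curve of a Bertrand pair, and the
derivative of the arc length correspondence. -/
theorem exists_curvature_relation {I J : Set ℝ} (hI : I.Nonempty) {κ h k₁ ψ : ℝ → ℝ} {μ c d : ℝ}
    (hJ : IsOpen J) (hψ : MapsTo ψ I J) (hsurj : SurjOn ψ I J) (hψ' : ∀ s ∈ I, 0 < deriv ψ s)
    (hh : ∀ t ∈ J, h t ≠ 0) (hκ : ∀ t ∈ J, HasDerivAt κ (k₁ t) t) (hk : ∀ t ∈ J, k₁ t ≠ 0)
    (hμ : μ ≠ 0) (hcd : c ^ 2 + d ^ 2 = 1)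
    (hc : ∀ s ∈ I, deriv ψ s * (1 + μ * κ (ψ s)) = c)
    (hd : ∀ s ∈ I, -(μ * deriv ψ s * h (ψ s)) = d) :
    ∃ r ν : ℝ, ν ≠ 0 ∧ (∀ t ∈ J, h t = r * κ t + ν) ∧
      ∀ s ∈ I, deriv ψ s ^ 2 * h (ψ s) ^ 2 * (1 + r ^ 2) = ν ^ 2 := by
  obtain ⟨s₀, hs₀⟩ := hI
  have hd0 : d ≠ 0 := by
    rw [← hd s₀ hs₀]
    exact neg_ne_zero.2 (mul_ne_zero (mul_ne_zero hμ (hψ' s₀ hs₀).ne') (hh _ (hψ hs₀)))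
  -- If `c = 0`, then `κ` is the constant `-1 / μ`, against `k₁ ≠ 0`.
  have hc0 : c ≠ 0 := by
    rintro rfl
    have h1 : ∀ t ∈ J, κ t = -1 / μ := by
      intro t ht
      obtain ⟨s, hs, rfl⟩ := hsurj ht
      have := (mul_eq_zero.1 (hc s hs)).resolve_left (hψ' s hs).ne'
      field_simp
      linarith
    refine hk _ (hψ hs₀) ((hκ _ (hψ hs₀)).unique
      ((hasDerivAt_const _ (-1 / μ)).congr_of_eventuallyEq ?_))
    filter_upwards [hJ.mem_nhds (hψ hs₀)] with t ht using h1 t ht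
  -- Eliminating `ψ'` gives `c μ h = -d (1 + μ κ)`. The speed formula then follows from `1 + r² = 1
  -- / c²`.
  refine ⟨-d / c, -d / (c * μ), div_ne_zero (neg_ne_zero.2 hd0) (mul_ne_zero hc0 hμ), ?_, ?_⟩
  · intro t ht
    obtain ⟨s, hs, rfl⟩ := hsurj ht
    have h1 := hc s hs
    have h2 := hd s hs
    have h3 := (hψ' s hs).ne'
    field_simp
    refine mul_left_cancel₀ h3 ?_
    linear_combination d * h1 - c * h2
  · intro s hs
    have h2 := hd s hs
    field_simp
    linear_combination (d ^ 2) * hcd + (-(μ * deriv ψ s * h (ψ s)) + d) * (c ^ 2 + d ^ 2) * h2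

variable {E : Type*} [NormedAddCommGroup E] [NormedSpace ℝ E] {g : E →L[ℝ] E →L[ℝ] ℝ}

/-- An orthonormal frame in the orientation class `o`. -/
structure IsOrientedFrame (g : E →L[ℝ] E →L[ℝ] ℝ) (o : Orientation ℝ E (Fin 3)) (T N B : E) :
    Prop extends IsOrthonormalFrame g T N B where
  oriented : ∃ b : Module.Basis (Fin 3) ℝ E, (∀ i, b i = ![T, N, B] i) ∧ b.orientation = o

theorem isOrthonormalFrame_of_basis (hg : ∀ x y, g x y = g y x) {T N B : E}
    (hTT : g T T = 1) (hNN : g N N = 1) (hBB : g B B = 1) (hTN : g T N = 0) (hTB : g T B = 0)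
    (hNB : g N B = 0) (b : Module.Basis (Fin 3) ℝ E) (hb : ∀ i, b i = ![T, N, B] i) :
    IsOrthonormalFrame g T N B := by
  refine ⟨hTT, hNN, hBB, hTN, hTB, hNB, fun x => ?_⟩
  have hx : b.repr x 0 • T + b.repr x 1 • N + b.repr x 2 • B = x := by
    have := b.sum_repr x
    simpa [Fin.sum_univ_three, hb] using this
  have h1 : g N T = 0 := by rw [hg, hTN]
  have h2 : g B T = 0 := by rw [hg, hTB]
  have h3 : g B N = 0 := by rw [hg, hNB]
  generalize b.repr x 0 = a₀ at hx
  generalize b.repr x 1 = a₁ at hx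
  generalize b.repr x 2 = a₂ at hx
  subst hx
  simp [hTT, hNN, hBB, hTN, hTB, hNB, h1, h2, h3]

/-- A frame whose coordinate matrix in an oriented frame is in `SO(3)` is an oriented frame. -/
theorem IsOrientedFrame.of_coords (hg : ∀ x y, g x y = g y x) {o : Orientation ℝ E (Fin 3)}
    {T N B T₁ N₁ B₁ : E} (hf : IsOrientedFrame g o T N B) {a₀ a₁ a₂ b₀ b₁ b₂ c₀ c₁ c₂ : ℝ}
    (hT : T₁ = a₀ • T + a₁ • N + a₂ • B) (hN : N₁ = b₀ • T + b₁ • N + b₂ • B)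
    (hB : B₁ = c₀ • T + c₁ • N + c₂ • B)
    (haa : a₀ * a₀ + a₁ * a₁ + a₂ * a₂ = 1) (hbb : b₀ * b₀ + b₁ * b₁ + b₂ * b₂ = 1)
    (hcc : c₀ * c₀ + c₁ * c₁ + c₂ * c₂ = 1) (hab : a₀ * b₀ + a₁ * b₁ + a₂ * b₂ = 0)
    (hac : a₀ * c₀ + a₁ * c₁ + a₂ * c₂ = 0) (hbc : b₀ * c₀ + b₁ * c₁ + b₂ * c₂ = 0)
    (hdet : a₀ * (b₁ * c₂ - b₂ * c₁) - a₁ * (b₀ * c₂ - b₂ * c₀) + a₂ * (b₀ * c₁ - b₁ * c₀) = 1) :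
    IsOrientedFrame g o T₁ N₁ B₁ := by
  obtain ⟨b, hb, ho⟩ := hf.oriented
  have hv : ∀ x₀ x₁ x₂ : ℝ, b.equivFun (x₀ • T + x₁ • N + x₂ • B) = ![x₀, x₁, x₂] := by
    intro x₀ x₁ x₂
    have : x₀ • T + x₁ • N + x₂ • B = b.equivFun.symm ![x₀, x₁, x₂] := by
      simp [Module.Basis.equivFun_symm_apply, Fin.sum_univ_three, hb]
    rw [this, LinearEquiv.apply_symm_apply]
  have hr : ∀ (x₀ x₁ x₂ : ℝ) (i : Fin 3),
      b.repr (x₀ • T + x₁ • N + x₂ • B) i = ![x₀, x₁, x₂] i := by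
    intro x₀ x₁ x₂ i
    rw [← hv x₀ x₁ x₂, Module.Basis.equivFun_apply]
  -- This determinant yields both that the new vectors form a basis and that its orientation is `o`.
  have hdet' : b.det ![T₁, N₁, B₁] = 1 := by
    rw [Module.Basis.det_apply, Matrix.det_fin_three, ← hdet]
    simp only [Module.Basis.toMatrix_apply, hT, hN, hB, Matrix.cons_val, hr]
    ring
  obtain ⟨hli, hsp⟩ := (b.is_basis_iff_det (v := ![T₁, N₁, B₁])).2 (by rw [hdet']; exact isUnit_one)
  have hb' : ∀ i, Module.Basis.mk hli hsp.ge i = ![T₁, N₁, B₁] i := fun i => by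
    rw [Module.Basis.mk_apply]
  refine ⟨isOrthonormalFrame_of_basis hg ?_ ?_ ?_ ?_ ?_ ?_ _ hb', _, hb', ?_⟩
  · rw [hT, hf.form_comb hg, haa]
  · rw [hN, hf.form_comb hg, hbb]
  · rw [hB, hf.form_comb hg, hcc]
  · rw [hT, hN, hf.form_comb hg, hab]
  · rw [hT, hB, hf.form_comb hg, hac]
  · rw [hN, hB, hf.form_comb hg, hbc]
  · rw [← ho, eq_comm, Module.Basis.orientation_eq_iff_det_pos, Module.Basis.coe_mk, hdet']
    exact one_pos

/-- A curve with Frenet frame `(T, N, B)`, curvature `κ` and harmonic curvature `H`, whose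
curvatures satisfy the relation `H' κ = κ' (ρ - H)` with a constant `ρ`. -/
structure IsBertrandMate (g : E →L[ℝ] E →L[ℝ] ℝ) (o : Orientation ℝ E (Fin 3)) (J : Set ℝ)
    (T N B : ℝ → E) (κ h H ρ k₁ k₂ Δ : ℝ → ℝ) : Prop extends IsFrenetCurve g J T N B κ h where
  oriented : ∀ t ∈ J, IsOrientedFrame g o (T t) (N t) (B t)
  curvature_pos : ∀ t ∈ J, 0 < κ t
  hasDerivAt_curvature : ∀ t ∈ J, HasDerivAt κ (k₁ t) t
  hasDerivAt_k₁ : ∀ t ∈ J, HasDerivAt k₁ (k₂ t) t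
  torsion_eq : ∀ t ∈ J, h t = κ t * H t
  hasDerivAt_H : ∀ t ∈ J, HasDerivAt H (k₁ t * (ρ t - H t) / κ t) t
  hasDerivAt_ρ : ∀ t ∈ J, HasDerivAt ρ 0 t
  discr_eq : ∀ t ∈ J, Δ t = k₁ t ^ 2 * (H t - ρ t) ^ 2 + κ t ^ 4 * (1 + H t ^ 2) ^ 3

/-- The unit tangent of the principal normal indicatrix. -/
def indicatrixT (ε : ℝ) (T B : ℝ → E) (H : ℝ → ℝ) (t : ℝ) : E :=
  (-ε / √(1 + H t ^ 2)) • (T t - H t • B t)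

/-- The principal normal of the principal normal indicatrix. -/
def indicatrixN (ε : ℝ) (T N B : ℝ → E) (κ H ρ k₁ Δ : ℝ → ℝ) (t : ℝ) : E :=
  (ε / (√(Δ t) * √(1 + H t ^ 2))) •
    ((H t * k₁ t * (ρ t - H t)) • T t - (κ t ^ 2 * (1 + H t ^ 2) ^ 2) • N t
      - (k₁ t * (H t - ρ t)) • B t)

/-- The binormal of the principal normal indicatrix. -/
def indicatrixB (T N B : ℝ → E) (κ H ρ k₁ Δ : ℝ → ℝ) (t : ℝ) : E :=
  (1 / √(Δ t)) • ((κ t ^ 2 * H t * (1 + H t ^ 2)) • T t + (k₁ t * (ρ t - H t)) • N t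
    + (κ t ^ 2 * (1 + H t ^ 2)) • B t)

/-- The curvature of the principal normal indicatrix. -/
def indicatrixCurvature (κ H Δ : ℝ → ℝ) (t : ℝ) : ℝ :=
  √(Δ t) / (κ t ^ 2 * (1 + H t ^ 2) ^ (3 / 2 : ℝ))

/-- The torsion of the principal normal indicatrix. -/
def indicatrixTorsion (ε : ℝ) (κ H ρ k₁ k₂ Δ : ℝ → ℝ) (t : ℝ) : ℝ :=
  ε * (H t - ρ t) * ((3 * k₁ t ^ 2 - k₂ t * κ t) * (1 + H t ^ 2)
    - 3 * k₁ t ^ 2 * H t * (H t - ρ t)) / Δ t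

namespace IsBertrandMate

variable {o : Orientation ℝ E (Fin 3)} {J : Set ℝ} {T N B : ℝ → E} {κ h H ρ k₁ k₂ Δ : ℝ → ℝ}
  {ε t : ℝ}

theorem discr_pos (hm : IsBertrandMate g o J T N B κ h H ρ k₁ k₂ Δ) (ht : t ∈ J) : 0 < Δ t := by
  have := hm.curvature_pos t ht
  rw [hm.discr_eq t ht]
  positivity

/-- The coordinate matrix in `(T, N, B)` lies in `SO(3)`: `Δ` is exactly the squared length of the
unnormalized binormal, and `ε² = 1` handles the sign. -/
theorem frame_indicatrix (hg : ∀ x y, g x y = g y x)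
    (hm : IsBertrandMate g o J T N B κ h H ρ k₁ k₂ Δ) (hε : ε ^ 2 = 1) (ht : t ∈ J) :
    IsOrientedFrame g o (indicatrixT ε T B H t) (indicatrixN ε T N B κ H ρ k₁ Δ t)
      (indicatrixB T N B κ H ρ k₁ Δ t) := by
  have hΔ := hm.discr_pos ht
  have hΔe := hm.discr_eq t ht
  have hκ := hm.curvature_pos t ht
  have hw : 0 < √(1 + H t ^ 2) := by positivity
  have hD : 0 < √(Δ t) := by positivity
  have hw2 : √(1 + H t ^ 2) ^ 2 = 1 + H t ^ 2 := Real.sq_sqrt (by positivity)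
  have hD2 : √(Δ t) ^ 2 = Δ t := Real.sq_sqrt hΔ.le
  refine (hm.oriented t ht).of_coords hg
    (a₀ := -ε / √(1 + H t ^ 2)) (a₁ := 0) (a₂ := ε * H t / √(1 + H t ^ 2))
    (b₀ := ε * (H t * k₁ t * (ρ t - H t)) / (√(Δ t) * √(1 + H t ^ 2)))
    (b₁ := -ε * (κ t ^ 2 * (1 + H t ^ 2) ^ 2) / (√(Δ t) * √(1 + H t ^ 2)))
    (b₂ := ε * (k₁ t * (ρ t - H t)) / (√(Δ t) * √(1 + H t ^ 2)))
    (c₀ := κ t ^ 2 * H t * (1 + H t ^ 2) / √(Δ t))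
    (c₁ := k₁ t * (ρ t - H t) / √(Δ t))
    (c₂ := κ t ^ 2 * (1 + H t ^ 2) / √(Δ t)) ?_ ?_ ?_ ?_ ?_ ?_ ?_ ?_ ?_ ?_
  · rw [indicatrixT]; module
  · rw [indicatrixN]; module
  · rw [indicatrixB]; module
  all_goals
    generalize √(1 + H t ^ 2) = w at *
    generalize √(Δ t) = D at *
    field_simp
  · linear_combination (1 + H t ^ 2) * hε - hw2
  · rw [hw2, hD2, hΔe]
    linear_combination (k₁ t ^ 2 * (H t - ρ t) ^ 2 + κ t ^ 4 * (1 + H t ^ 2) ^ 3) *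
      (1 + H t ^ 2) * hε
  · rw [hD2, hΔe]; ring
  · ring
  · ring
  · ring
  · rw [hw2, hD2, hΔe]
    linear_combination (k₁ t ^ 2 * (H t - ρ t) ^ 2 + κ t ^ 4 * (1 + H t ^ 2) ^ 3) *
      (1 + H t ^ 2) * hε

/-- The parameter is that of the mate, in which the normal `N` has speed `κ √(1 + H²)`; the relation
for `H'` eliminates the derivative of `H`. -/
theorem hasDerivAt_indicatrixT (hm : IsBertrandMate g o J T N B κ h H ρ k₁ k₂ Δ)
    (ht : t ∈ J) :
    HasDerivAt (indicatrixT ε T B H)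
      ((κ t * √(1 + H t ^ 2)) • (indicatrixCurvature κ H Δ t • indicatrixN ε T N B κ H ρ k₁ Δ t))
      t := by
  have hκ := hm.curvature_pos t ht
  have hq : 0 < 1 + H t ^ 2 := by positivity
  have hw : 0 < √(1 + H t ^ 2) := by positivity
  have hD : 0 < √(Δ t) := Real.sqrt_pos.2 (hm.discr_pos ht)
  have hw2 : √(1 + H t ^ 2) ^ 2 = 1 + H t ^ 2 := Real.sq_sqrt hq.le
  have hH := hm.hasDerivAt_H t ht
  have hwd : HasDerivAt (fun u => √(1 + H u ^ 2))
      (H t * (k₁ t * (ρ t - H t) / κ t) / √(1 + H t ^ 2)) t := by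
    refine (((hH.fun_pow 2).const_add 1).sqrt hq.ne').congr_deriv ?_
    simp only [Nat.cast_ofNat, Nat.add_one_sub_one, pow_one]
    field_simp
  have h1 := hm.hasDerivAt_comb ht ((hasDerivAt_const t (-ε)).div hwd hw.ne')
    (hasDerivAt_const t (0 : ℝ)) ((hH.const_mul ε).div hwd hw.ne')
  refine (h1.congr_of_eventuallyEq (Filter.Eventually.of_forall fun u => ?_)).congr_deriv ?_
  · simp only [indicatrixT, Pi.div_apply]; module
  -- With the real power written as a cube of the root, the identities become polynomial in that
  -- root.
  · have hrpow : (1 + H t ^ 2) ^ (3 / 2 : ℝ) = √(1 + H t ^ 2) ^ 3 := by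
      generalize 1 + H t ^ 2 = q at *
      rw [Real.sqrt_eq_rpow, ← Real.rpow_natCast, ← Real.rpow_mul hq.le]
      norm_num
    rw [indicatrixCurvature, indicatrixN, hrpow, hm.torsion_eq t ht]
    simp only [Pi.div_apply]
    generalize √(1 + H t ^ 2) = w at *
    generalize √(Δ t) = D at *
    match_scalars
    · field_simp
      ring
    · field_simp
      rw [← hw2]
      linear_combination (κ t * ε * w ^ 2) * hw2
    · field_simp
      linear_combination (k₁ t * (ρ t - H t) * ε) * hw2

theorem differentiableAt_discr (hm : IsBertrandMate g o J T N B κ h H ρ k₁ k₂ Δ) (hJ : IsOpen J)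
    (ht : t ∈ J) : DifferentiableAt ℝ Δ t := by
  have h1 := (hm.hasDerivAt_H t ht).differentiableAt
  have h2 := (hm.hasDerivAt_curvature t ht).differentiableAt
  have h3 := (hm.hasDerivAt_k₁ t ht).differentiableAt
  have h4 := (hm.hasDerivAt_ρ t ht).differentiableAt
  have h5 : DifferentiableAt ℝ
      (fun t => k₁ t ^ 2 * (H t - ρ t) ^ 2 + κ t ^ 4 * (1 + H t ^ 2) ^ 3) t := by fun_prop
  refine h5.congr_of_eventuallyEq ?_
  filter_upwards [hJ.mem_nhds ht] with u hu using hm.discr_eq u hu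

/-- Only this component of `B'` has to be computed; `frenet_of_frame` recovers the others and the
derivative of the normal. -/
theorem form_deriv_indicatrixB (hg : ∀ x y, g x y = g y x)
    (hm : IsBertrandMate g o J T N B κ h H ρ k₁ k₂ Δ) (hJ : IsOpen J) (ht : t ∈ J) :
    ∃ B', HasDerivAt (indicatrixB T N B κ H ρ k₁ Δ) B' t ∧
      g B' (indicatrixN ε T N B κ H ρ k₁ Δ t) =
        -(κ t * √(1 + H t ^ 2) * indicatrixTorsion ε κ H ρ k₁ k₂ Δ t) := by
  have hκ := hm.curvature_pos t ht
  have hq : 0 < 1 + H t ^ 2 := by positivity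
  have hw : 0 < √(1 + H t ^ 2) := by positivity
  have hΔ := hm.discr_pos ht
  have hD : 0 < √(Δ t) := Real.sqrt_pos.2 hΔ
  have hD2 : √(Δ t) ^ 2 = Δ t := Real.sq_sqrt hΔ.le
  have hw2 : √(1 + H t ^ 2) ^ 2 = 1 + H t ^ 2 := Real.sq_sqrt hq.le
  have hH := hm.hasDerivAt_H t ht
  have hκd := hm.hasDerivAt_curvature t ht
  have hqd := (hH.fun_pow 2).const_add 1
  have hv := hm.hasDerivAt_comb ht (((hκd.fun_pow 2).fun_mul hH).fun_mul hqd)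
    ((hm.hasDerivAt_k₁ t ht).fun_mul ((hm.hasDerivAt_ρ t ht).fun_sub hH))
    ((hκd.fun_pow 2).fun_mul hqd)
  have hf : DifferentiableAt ℝ (fun u => 1 / √(Δ u)) t := by
    have := hm.differentiableAt_discr hJ ht
    exact (differentiableAt_const _).fun_div (this.sqrt hΔ.ne') hD.ne'
  refine ⟨_, hf.hasDerivAt.smul hv, ?_⟩
  have hN : indicatrixN ε T N B κ H ρ k₁ Δ t =
      (ε / (√(Δ t) * √(1 + H t ^ 2)) * (H t * k₁ t * (ρ t - H t))) • T t +
      (-ε / (√(Δ t) * √(1 + H t ^ 2)) * (κ t ^ 2 * (1 + H t ^ 2) ^ 2)) • N t +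
      (ε / (√(Δ t) * √(1 + H t ^ 2)) * (k₁ t * (ρ t - H t))) • B t := by
    rw [indicatrixN]; module
  rw [hN, map_add g, map_smul g, map_smul g, _root_.add_apply, _root_.smul_apply, _root_.smul_apply,
    (hm.frame t ht).form_comb hg, (hm.frame t ht).form_comb hg, indicatrixTorsion,
    hm.torsion_eq t ht, smul_eq_mul, smul_eq_mul]
  -- The derivative of the normalizing factor multiplies the pairing of the binormal direction with
  -- the normal, which is zero, so its value is irrelevant.
  generalize deriv (fun u => 1 / √(Δ u)) t = f'
  generalize √(1 + H t ^ 2) = w at *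
  generalize √(Δ t) = D at *
  rw [← hD2]
  simp only [Nat.cast_ofNat, Nat.add_one_sub_one, pow_one]
  field_simp
  rw [hw2]
  ring

theorem differentiableAt_indicatrixN (hm : IsBertrandMate g o J T N B κ h H ρ k₁ k₂ Δ)
    (hJ : IsOpen J) (ht : t ∈ J) :
    DifferentiableAt ℝ (indicatrixN ε T N B κ H ρ k₁ Δ) t := by
  have hΔ := hm.discr_pos ht
  have hq : 0 < 1 + H t ^ 2 := by positivity
  have h1 := (hm.hasDerivAt_H t ht).differentiableAt
  have h2 := (hm.hasDerivAt_curvature t ht).differentiableAt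
  have h3 := (hm.hasDerivAt_k₁ t ht).differentiableAt
  have h4 := (hm.hasDerivAt_ρ t ht).differentiableAt
  have h5 := (hm.hasDerivAt_T t ht).differentiableAt
  have h6 := (hm.hasDerivAt_N t ht).differentiableAt
  have h7 := (hm.hasDerivAt_B t ht).differentiableAt
  have h8 := (hm.differentiableAt_discr hJ ht).sqrt hΔ.ne'
  have h9 : DifferentiableAt ℝ (fun u => √(1 + H u ^ 2)) t :=
    DifferentiableAt.sqrt (by fun_prop) hq.ne'
  have h10 : √(Δ t) * √(1 + H t ^ 2) ≠ 0 :=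
    mul_ne_zero (Real.sqrt_ne_zero'.2 hΔ) (Real.sqrt_ne_zero'.2 hq)
  unfold indicatrixN
  exact ((differentiableAt_const _).fun_div (h8.fun_mul h9) h10).fun_smul (by fun_prop)

/-- The Frenet equations of the principal normal indicatrix. -/
theorem frenet_indicatrix (hg : ∀ x y, g x y = g y x)
    (hm : IsBertrandMate g o J T N B κ h H ρ k₁ k₂ Δ) (hJ : IsOpen J) (hε : ε ^ 2 = 1)
    (ht : t ∈ J) :
    HasDerivAt (indicatrixN ε T N B κ H ρ k₁ Δ)
      ((κ t * √(1 + H t ^ 2)) • (-(indicatrixCurvature κ H Δ t) • indicatrixT ε T B H t +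
        indicatrixTorsion ε κ H ρ k₁ k₂ Δ t • indicatrixB T N B κ H ρ k₁ Δ t)) t ∧
    HasDerivAt (indicatrixB T N B κ H ρ k₁ Δ)
      ((κ t * √(1 + H t ^ 2)) • (-(indicatrixTorsion ε κ H ρ k₁ k₂ Δ t) •
        indicatrixN ε T N B κ H ρ k₁ Δ t)) t := by
  obtain ⟨B', hB', hτ⟩ := hm.form_deriv_indicatrixB hg hJ ht (ε := ε)
  have hN := (hm.differentiableAt_indicatrixN (ε := ε) hJ ht).hasDerivAt
  have hf : ∀ᶠ u in 𝓝 t, IsOrthonormalFrame g (indicatrixT ε T B H u)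
      (indicatrixN ε T N B κ H ρ k₁ Δ u) (indicatrixB T N B κ H ρ k₁ Δ u) := by
    filter_upwards [hJ.mem_nhds ht] with u hu
    exact (hm.frame_indicatrix hg hε hu).toIsOrthonormalFrame
  obtain ⟨h1, h2⟩ := frenet_of_frame hg hf
    ((hm.hasDerivAt_indicatrixT ht).congr_deriv (smul_smul _ _ _)) hN hB' hτ
  refine ⟨hN.congr_deriv ?_, hB'.congr_deriv ?_⟩
  · rw [h1]; module
  · rw [h2]; module

end IsBertrandMate

end PrincipalNormalIndicatrix

/-! ### Correction terms in the Frenet equations, and the apparatus along a Bertrand pair. -/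

section BertrandPairs

open Topology

variable {E : Type*} [NormedAddCommGroup E] [NormedSpace ℝ E] {g : E →L[ℝ] E →L[ℝ] ℝ}

/-- Smoothness is given only for pairings with fixed vectors; expanding `W` in one fixed frame
recovers the vector-valued derivative. -/
theorem IsOrthonormalFrame.differentiableAt (hg : ∀ x y, g x y = g y x) {W : ℝ → E} {I : Set ℝ}
    (hW : ∀ X, ContDiffOn ℝ ∞ (fun s => g X (W s)) I) (hI : IsOpen I)
    {T N B : E} (hf : IsOrthonormalFrame g T N B) {s : ℝ}
    (hs : s ∈ I) : DifferentiableAt ℝ W s := by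
  have h : ∀ X, DifferentiableAt ℝ (fun u => g (W u) X) s := fun X => by
    simp only [hg _ X]
    exact ((hW X).contDiffAt (hI.mem_nhds hs)).differentiableAt (by simp)
  rw [show W = fun u => g (W u) T • T + g (W u) N • N + g (W u) B • B from
    funext fun u => hf.expansion (W u)]
  exact (((h T).smul_const T).add ((h N).smul_const N)).add ((h B).smul_const B)

/-- The Frenet equations for a frame with `T' = κ N` and `N' = -κ T + τ B` up to correction terms
`P` and `Q`, of which the first is zero. -/
theorem isFrenetCurve_of_correction (hg : ∀ x y, g x y = g y x) {I : Set ℝ} (hI : IsOpen I)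
    {T N B P Q : ℝ → E} {κ τ : ℝ → ℝ}
    (hf : ∀ s ∈ I, IsOrthonormalFrame g (T s) (N s) (B s))
    (hT : ∀ X, ContDiffOn ℝ ∞ (fun s => g X (T s)) I)
    (hN : ∀ X, ContDiffOn ℝ ∞ (fun s => g X (N s)) I)
    (hB : ∀ X, ContDiffOn ℝ ∞ (fun s => g X (B s)) I)
    (hTd : ∀ s ∈ I, deriv T s + (1 / 2 : ℝ) • P s = κ s • N s) (hP : ∀ s ∈ I, P s = 0)
    (hNd : ∀ s ∈ I, deriv N s + (1 / 2 : ℝ) • Q s = -(κ s) • T s + τ s • B s) :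
    IsFrenetCurve g I T N B κ (fun s => τ s - 1 / 2 * g (Q s) (B s)) := by
  have hT' : ∀ s ∈ I, HasDerivAt T (κ s • N s) s := fun s hs => by
    have h1 := ((hf s hs).differentiableAt hg hT hI hs).hasDerivAt
    have h2 := hTd s hs
    rw [hP s hs, smul_zero, add_zero] at h2
    rwa [h2] at h1
  have hN' := fun s hs => ((hf s hs).differentiableAt hg hN hI hs).hasDerivAt
  have hB' := fun s hs => ((hf s hs).differentiableAt hg hB hI hs).hasDerivAt
  have key : ∀ s ∈ I, deriv N s = -(κ s) • T s + (τ s - 1 / 2 * g (Q s) (B s)) • B s ∧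
      deriv B s = -(τ s - 1 / 2 * g (Q s) (B s)) • N s := fun s hs => by
    have hev : ∀ᶠ u in 𝓝 s, IsOrthonormalFrame g (T u) (N u) (B u) := by
      filter_upwards [hI.mem_nhds hs] with u hu using hf u hu
    refine frenet_of_frame hg hev (hT' s hs) (hN' s hs) (hB' s hs) ?_
    have h3 := form_deriv_add_eq_zero (hN' s hs) (hB' s hs) (hev.mono fun u hu => hu.NB)
    -- Only the `B`-component of the correction matters, since orthonormality determines the other
    -- components of `N'`.
    have h5 : g (deriv N s) (B s) = τ s - 1 / 2 * g (Q s) (B s) := by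
      rw [eq_sub_of_add_eq (hNd s hs)]
      simp [(hf s hs).TB, (hf s hs).BB]
    rw [hg, ← h5]
    linarith
  refine ⟨hf, hT', fun s hs => ?_, fun s hs => ?_⟩
  · rw [← (key s hs).1]
    exact hN' s hs
  · rw [← (key s hs).2]
    exact hB' s hs

/-- `γ` is a regular curve on `I` with arc length `σ` and the given Frenet apparatus. -/
structure HasFrenetApparatus (g : E →L[ℝ] E →L[ℝ] ℝ) (o : Orientation ℝ E (Fin 3)) (I : Set ℝ)
    (γ : ℝ → E) (σ : ℝ → ℝ) (T N B : ℝ → E) (κ h : ℝ → ℝ) : Prop where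
  differentiable : ∀ s ∈ I, DifferentiableAt ℝ γ s
  regular : ∀ s ∈ I, 0 < g (deriv γ s) (deriv γ s)
  arcLength : ∀ s ∈ I, HasDerivAt σ (√(g (deriv γ s) (deriv γ s))) s
  frame : ∀ s ∈ I, IsOrientedFrame g o (T s) (N s) (B s)
  curvature_pos : ∀ s ∈ I, 0 < κ s
  tangent : ∀ s ∈ I, HasDerivAt γ (deriv σ s • T s) s
  frenet_T : ∀ s ∈ I, HasDerivAt T (deriv σ s • (κ s • N s)) s
  frenet_N : ∀ s ∈ I, HasDerivAt N (deriv σ s • (-(κ s) • T s + h s • B s)) s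
  frenet_B : ∀ s ∈ I, HasDerivAt B (deriv σ s • (-(h s) • N s)) s

/-- The Frenet apparatus of the principal normal indicatrix of a curve of a Bertrand pair. -/
theorem exists_hasFrenetApparatus_indicatrix (hg : ∀ x y, g x y = g y x)
    {o : Orientation ℝ E (Fin 3)} {I J : Set ℝ} (hIopen : IsOpen I) (hIconn : I.OrdConnected)
    (hJopen : IsOpen J) {T N B Tt Nt Bt A At : ℝ → E} {κ h κt ht ψ : ℝ → ℝ}
    (hC : IsFrenetCurve g I T N B κ h) (hCt : IsFrenetCurve g J Tt Nt Bt κt ht)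
    (hor : ∀ t ∈ J, IsOrientedFrame g o (Tt t) (Nt t) (Bt t)) (hκpos : ∀ t ∈ J, 0 < κt t)
    (hκsmooth : ContDiffOn ℝ ∞ κt J) (hbij : BijOn ψ I J)
    (hdiff : ∀ s ∈ I, DifferentiableAt ℝ ψ s) (hψpos : ∀ s ∈ I, 0 < deriv ψ s)
    (hA : ∀ s ∈ I, HasDerivAt A (T s) s) (hAt : ∀ t ∈ J, HasDerivAt At (Tt t) t)
    (hline : ∀ s ∈ I, Set.range (fun r : ℝ => A s + r • N s) =
      Set.range (fun r : ℝ => At (ψ s) + r • Nt (ψ s)))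
    (hne : ∃ s ∈ I, A s ≠ At (ψ s)) (hκt : ∀ t ∈ J, deriv κt t ≠ 0)
    {H ρ k₁ k₂ Δ : ℝ → ℝ} (hH : H = fun t => ht t / κt t)
    (hρ : ρ = fun t => deriv ht t / deriv κt t) (hH0 : ∀ t ∈ J, H t ≠ 0)
    (hk₁ : k₁ = deriv κt) (hk₂ : k₂ = deriv (deriv κt))
    (hΔ : Δ = fun t => k₁ t ^ 2 * (H t - ρ t) ^ 2 + κt t ^ 4 * (1 + H t ^ 2) ^ 3) :
    ∃ ε : ℝ, (ε = 1 ∨ ε = -1) ∧ (∀ s ∈ I, N s = ε • Nt (ψ s)) ∧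
      (∀ t ∈ J, ρ t - H t ≠ 0) ∧
      ∀ s₀ ∈ I, HasFrenetApparatus g o I N
        (fun s => ∫ u in s₀..s,
          κt (ψ u) * |ρ (ψ u) - H (ψ u)| * √(1 + H (ψ u) ^ 2)
            / (|H (ψ u)| * √(1 + ρ (ψ u) ^ 2)))
        (fun s => indicatrixT ε Tt Bt H (ψ s))
        (fun s => indicatrixN ε Tt Nt Bt κt H ρ k₁ Δ (ψ s))
        (fun s => indicatrixB Tt Nt Bt κt H ρ k₁ Δ (ψ s))
        (fun s => indicatrixCurvature κt H Δ (ψ s))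
        (fun s => indicatrixTorsion ε κt H ρ k₁ k₂ Δ (ψ s)) := by
  have hmaps := hbij.mapsTo
  obtain ⟨ε, hε, hN, μ, c, d, hμ, hcd, hc, hd⟩ :=
    exists_bertrand_constants hg hIopen hIconn hC hCt hA hAt hmaps hdiff hline hne
  have hh : ∀ t ∈ J, ht t = κt t * H t := fun t htJ => by
    simp only [hH]; rw [mul_div_cancel₀ _ (hκpos t htJ).ne']
  have hκd : ∀ t ∈ J, HasDerivAt κt (k₁ t) t := fun t htJ => by
    rw [hk₁]
    exact ((hκsmooth.contDiffAt (hJopen.mem_nhds htJ)).differentiableAt (by simp)).hasDerivAt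
  have hkd : ∀ t ∈ J, HasDerivAt k₁ (k₂ t) t := fun t htJ => by
    rw [hk₁, hk₂]
    exact (((hκsmooth.deriv_of_isOpen hJopen (m := ∞) (by simp)).contDiffAt
      (hJopen.mem_nhds htJ)).differentiableAt (by simp)).hasDerivAt
  obtain ⟨s₁, hs₁, -⟩ := hne
  obtain ⟨r, ν, hν, hrel, hψ⟩ := exists_curvature_relation ⟨s₁, hs₁⟩ hJopen hmaps
    hbij.surjOn hψpos
    (fun t htJ => by rw [hh t htJ]; exact mul_ne_zero (hκpos t htJ).ne' (hH0 t htJ)) hκd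
    (fun t htJ => by rw [hk₁]; exact hκt t htJ) hμ hcd hc hd
  have hρr : ∀ t ∈ J, ρ t = r := fun t htJ => by
    have h1 : HasDerivAt ht (r * k₁ t) t := by
      refine (((hκd t htJ).const_mul r).add_const ν).congr_of_eventuallyEq ?_
      filter_upwards [hJopen.mem_nhds htJ] with u hu using hrel u hu
    rw [hρ]
    simp only
    rw [h1.deriv, hk₁, mul_div_cancel_right₀ _ (hκt t htJ)]
  have hHr : ∀ t ∈ J, H t = r + ν / κt t := fun t htJ => by
    have h0 := (hκpos t htJ).ne'
    have h1 := hrel t htJ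
    rw [hh t htJ] at h1
    field_simp
    linarith
  have hm : IsBertrandMate g o J Tt Nt Bt κt ht H ρ k₁ k₂ Δ := by
    refine ⟨hCt, hor, hκpos, hκd, hkd, hh,
      fun t htJ => ?_, fun t htJ => ?_, fun t _ => by rw [hΔ]⟩
    · have h0 := (hκpos t htJ).ne'
      have h1 : HasDerivAt H _ t := (((hasDerivAt_const t ν).fun_div (hκd t htJ) h0).const_add
        r).congr_of_eventuallyEq (by
          filter_upwards [hJopen.mem_nhds htJ] with u hu using hHr u hu)
      refine h1.congr_deriv ?_
      rw [hρr t htJ, hHr t htJ]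
      field_simp
      ring
    · refine (hasDerivAt_const t r).congr_of_eventuallyEq ?_
      filter_upwards [hJopen.mem_nhds htJ] with u hu using hρr u hu
  have hε2 : ε ^ 2 = 1 := by rcases hε with rfl | rfl <;> norm_num
  have hρH : ∀ t ∈ J, ρ t - H t ≠ 0 := fun t htJ => by
    rw [hρr t htJ, hHr t htJ, sub_add_cancel_left]
    exact neg_ne_zero.2 (div_ne_zero hν (hκpos t htJ).ne')
  refine ⟨ε, hε, hN, hρH, fun s₀ hs₀ => ?_⟩
  set f : ℝ → ℝ := fun u => κt (ψ u) * |ρ (ψ u) - H (ψ u)| * √(1 + H (ψ u) ^ 2)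
    / (|H (ψ u)| * √(1 + ρ (ψ u) ^ 2)) with hf
  have hψd : ∀ s ∈ I, HasDerivAt ψ (deriv ψ s) s := fun s hs =>
    (hdiff s hs).hasDerivAt
  -- This amounts to `|ρ - H| = ψ' |H| √(1 + ρ²)`. Both sides are nonnegative, and after
  -- multiplication by `κt²` their squares both equal `ν²`.
  have hspeed : ∀ s ∈ I, f s = deriv ψ s * (κt (ψ s) * √(1 + H (ψ s) ^ 2)) := fun s hs => by
    have htJ := hmaps hs
    have hκ := hκpos _ htJ
    have hH' := hH0 _ htJ
    have h1 : |ρ (ψ s) - H (ψ s)| = deriv ψ s * (|H (ψ s)| * √(1 + ρ (ψ s) ^ 2)) := by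
      have h0 := hψpos s hs
      rw [← abs_of_nonneg (show 0 ≤ deriv ψ s * (|H (ψ s)| * √(1 + ρ (ψ s) ^ 2)) by positivity),
        ← sq_eq_sq_iff_abs_eq_abs, mul_pow, mul_pow, sq_abs, Real.sq_sqrt (by positivity),
        hρr _ htJ]
      have h2 := hψ s hs
      rw [hh _ htJ] at h2
      have h3 : κt (ψ s) * (r - H (ψ s)) = -ν := by
        rw [hHr _ htJ]
        field_simp
        ring
      refine mul_left_cancel₀ (pow_ne_zero 2 hκ.ne') ?_
      linear_combination (κt (ψ s) * (r - H (ψ s)) - ν) * h3 - h2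
    have h4 : 0 < |H (ψ s)| := abs_pos.2 hH'
    have h5 : 0 < √(1 + ρ (ψ s) ^ 2) := by positivity
    simp only [hf]
    rw [h1]
    field_simp
  have hfpos : ∀ s ∈ I, 0 < f s := fun s hs => by
    have h1 := hψpos s hs
    have h2 := hκpos _ (hmaps hs)
    rw [hspeed s hs]
    positivity
  have hfcont : ContinuousOn f I := fun s hs => by
    have htJ := hmaps hs
    have h0 := (hψd s hs).continuousAt
    have h1 : ContinuousAt (fun u => κt (ψ u)) s := (hκd _ htJ).continuousAt.comp h0
    have h2 : ContinuousAt (fun u => H (ψ u)) s := (hm.hasDerivAt_H _ htJ).continuousAt.comp h0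
    have h3 : ContinuousAt (fun u => ρ (ψ u)) s := (hm.hasDerivAt_ρ _ htJ).continuousAt.comp h0
    have h4 : |H (ψ s)| * √(1 + ρ (ψ s) ^ 2) ≠ 0 :=
      mul_ne_zero (abs_ne_zero.2 (hH0 _ htJ))
      (Real.sqrt_ne_zero'.2 (by positivity))
    exact (((h1.mul (h3.sub h2).abs).mul ((h2.pow 2).const_add 1).sqrt).div
      (h2.abs.mul ((h3.pow 2).const_add 1).sqrt) h4).continuousWithinAt
  have hσ : ∀ s ∈ I, HasDerivAt (fun s => ∫ u in s₀..s, f u) (f s) s := fun s hs =>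
    intervalIntegral.integral_hasDerivAt_right
      ((hfcont.mono (hIconn.uIcc_subset hs₀ hs)).intervalIntegrable)
      (hfcont.stronglyMeasurableAtFilter hIopen s hs) (hfcont.continuousAt (hIopen.mem_nhds hs))
  have htan : ∀ s ∈ I, HasDerivAt N (f s • indicatrixT ε Tt Bt H (ψ s)) s := fun s hs => by
    have htJ := hmaps hs
    have h1 : HasDerivAt N _ s := (((hCt.hasDerivAt_N _ htJ).scomp s (hψd s hs)).const_smul
      ε).congr_of_eventuallyEq (by
        filter_upwards [hIopen.mem_nhds hs] with u hu using hN u hu)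
    refine h1.congr_deriv ?_
    have hw : √(1 + H (ψ s) ^ 2) ≠ 0 := by positivity
    rw [hspeed s hs, indicatrixT, hh _ htJ]
    match_scalars <;> field_simp
  have hframe := fun s hs => hm.frame_indicatrix hg hε2 (hmaps (x := s) hs)
  have hdot : ∀ s ∈ I, g (deriv N s) (deriv N s) = f s ^ 2 := fun s hs => by
    rw [(htan s hs).deriv]
    rw [map_smul, map_smul, _root_.smul_apply, (hframe s hs).TT, smul_eq_mul, smul_eq_mul]
    ring
  -- The chain rule for `ψ` turns the speed in the mate's parameter into `f`, the derivative of the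
  -- arc length, so each Frenet equation transfers.
  have hcomp : ∀ s ∈ I, ∀ {X : ℝ → E} {X' : E},
      HasDerivAt X ((κt (ψ s) * √(1 + H (ψ s) ^ 2)) • X') (ψ s) →
      HasDerivAt (fun u => X (ψ u)) (deriv (fun s => ∫ u in s₀..s, f u) s • X') s :=
    fun s hs X X' hX => by
      rw [(hσ s hs).deriv, hspeed s hs, mul_smul]
      exact hX.scomp s (hψd s hs)
  exact
    { differentiable := fun s hs => (htan s hs).differentiableAt
      regular := fun s hs => by rw [hdot s hs]; exact pow_pos (hfpos s hs) 2
      arcLength := fun s hs => by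
        rw [hdot s hs, Real.sqrt_sq (hfpos s hs).le]
        exact hσ s hs
      frame := hframe
      curvature_pos := fun s hs => by
        have h1 := hκpos _ (hmaps hs)
        have h2 := hm.discr_pos (hmaps hs)
        unfold indicatrixCurvature
        positivity
      tangent := fun s hs => by
        rw [(hσ s hs).deriv]
        exact htan s hs
      frenet_T := fun s hs => hcomp s hs (hm.hasDerivAt_indicatrixT (hmaps hs))
      frenet_N := fun s hs =>
        hcomp s hs (hm.frenet_indicatrix hg hJopen hε2 (hmaps hs)).1
      frenet_B := fun s hs =>
        hcomp s hs (hm.frenet_indicatrix hg hJopen hε2 (hmaps hs)).2 }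

end BertrandPairs

/-! ### Passage from the Lie group to its Lie algebra with the metric as bilinear form. -/

section LieGroups

variable {G : Type*} [TopologicalSpace G] [ChartedSpace (EuclideanSpace ℝ (Fin 3)) G] [Group G]
  [LieGroup (𝓡 3) ∞ G]

/-- The inner product on the Lie algebra as a continuous bilinear form on its model space. -/
def BiInvariantMetric.form (m : BiInvariantMetric G) :
    EuclideanSpace ℝ (Fin 3) →L[ℝ] EuclideanSpace ℝ (Fin 3) →L[ℝ] ℝ :=
  m.toMetric.inner (1 : G)

theorem BiInvariantMetric.form_symm (m : BiInvariantMetric G) (v w : EuclideanSpace ℝ (Fin 3)) :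
    m.form v w = m.form w v :=
  m.toMetric.symm (1 : G) v w

theorem IsPositiveFrame.isOrientedFrame {m : BiInvariantMetric G}
    {o : Orientation ℝ (GroupLieAlgebra (𝓡 3) G) (Fin 3)} {T N B : GroupLieAlgebra (𝓡 3) G}
    (h : IsPositiveFrame m o T N B) :
    IsOrientedFrame (E := EuclideanSpace ℝ (Fin 3)) m.form o T N B := by
  obtain ⟨b, hb, ho⟩ := h.oriented
  exact ⟨isOrthonormalFrame_of_basis m.form_symm h.dot_TT h.dot_NN h.dot_BB h.dot_TN h.dot_TB
    h.dot_NB b hb, b, hb, ho⟩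

theorem IsOrientedFrame.isPositiveFrame {m : BiInvariantMetric G}
    {o : Orientation ℝ (GroupLieAlgebra (𝓡 3) G) (Fin 3)} {T N B : GroupLieAlgebra (𝓡 3) G}
    (h : IsOrientedFrame (E := EuclideanSpace ℝ (Fin 3)) m.form o T N B) :
    IsPositiveFrame m o T N B :=
  ⟨h.TT, h.NN, h.BB, h.TN, h.TB, h.NB, h.oriented⟩

/-- The Frenet equations for the derivative of components, with the modified torsion. -/
theorem IsFrenetApparatus.isFrenetCurve {m : BiInvariantMetric G}
    {o : Orientation ℝ (GroupLieAlgebra (𝓡 3) G) (Fin 3)} {I : Set ℝ} {α : ℝ → G}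
    {T N B : ℝ → GroupLieAlgebra (𝓡 3) G} {κ τ : ℝ → ℝ} (hI : IsOpen I)
    (h : IsFrenetApparatus m o I α T N B κ τ) :
    IsFrenetCurve (E := EuclideanSpace ℝ (Fin 3)) m.form I T N B κ
      (modifiedTorsion m T N B τ) :=
  -- The corrections are the brackets of the connection: `[T, T] = 0`, and `½ ⟨[T, N], B⟩` is the
  -- group torsion.
  isFrenetCurve_of_correction m.form_symm hI (P := fun s => (⁅T s, T s⁆ : GroupLieAlgebra (𝓡 3) G))
    (Q := fun s => (⁅T s, N s⁆ : GroupLieAlgebra (𝓡 3) G))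
    (fun s hs => (h.frame s hs).isOrientedFrame.toIsOrthonormalFrame)
    h.smooth_T h.smooth_N h.smooth_B h.frenet_T (fun s _ => by
      rw [GroupLieAlgebra.bracket_def, VectorField.mlieBracket_self]; rfl) h.frenet_N

end LieGroups

end
theorem theorem3p8 {G : Type*} [TopologicalSpace G]
    [ChartedSpace (EuclideanSpace ℝ (Fin 3)) G] [Group G] [LieGroup (𝓡 3) ∞ G]
    (m : BiInvariantMetric G) (o : Orientation ℝ (GroupLieAlgebra (𝓡 3) G) (Fin 3))
    (I J : Set ℝ) (hIopen : IsOpen I) (hIconn : I.OrdConnected)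
    (hJopen : IsOpen J) (hJconn : J.OrdConnected)
    -- the curve `α` and its Bertrand mate `αt`, with their Frenet apparatus
    (α αt : ℝ → G) (T N B Tt Nt Bt : ℝ → GroupLieAlgebra (𝓡 3) G) (κ τ κt τt : ℝ → ℝ)
    (hα : IsFrenetApparatus m o I α T N B κ τ)
    (hαt : IsFrenetApparatus m o J αt Tt Nt Bt κt τt)
    -- the arc length of `αt` as a function of the arc length of `α`
    (ψ : ℝ → ℝ) (hpair : IsBertrandPair I J α αt N Nt ψ)
    -- the denominators of `ρ` and of the arc length formula
    (hκt : ∀ t ∈ J, deriv κt t ≠ 0)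
    (H ρ : ℝ → ℝ) (hH : H = harmonicCurvature m Tt Nt Bt κt τt)
    (hρ : ρ = fun t => deriv (modifiedTorsion m Tt Nt Bt τt) t / deriv κt t)
    (hH0 : ∀ t ∈ J, H t ≠ 0)
    -- the first two derivatives of the curvature of `αt`, and the quantity under the roots
    (k₁ k₂ Δ : ℝ → ℝ) (hk₁ : k₁ = deriv κt) (hk₂ : k₂ = deriv (deriv κt))
    (hΔ : Δ = fun t => k₁ t ^ 2 * (H t - ρ t) ^ 2 + κt t ^ 4 * (1 + H t ^ 2) ^ 3) :
    ∃ ε : ℝ, (ε = 1 ∨ ε = -1) ∧ (∀ s ∈ I, N s = ε • Nt (ψ s)) ∧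
      (∀ t ∈ J, ρ t - H t ≠ 0) ∧
      ∀ s₀ ∈ I, IsIndicatrixFrenetApparatus m o I N
        -- `s_n`
        (fun s => ∫ u in s₀..s,
          κt (ψ u) * |ρ (ψ u) - H (ψ u)| * √(1 + H (ψ u) ^ 2)
            / (|H (ψ u)| * √(1 + ρ (ψ u) ^ 2)))
        -- `T_n`
        (fun s => (-ε / √(1 + H (ψ s) ^ 2)) • (Tt (ψ s) - H (ψ s) • Bt (ψ s)))
        -- `N_n`
        (fun s => (ε / (√(Δ (ψ s)) * √(1 + H (ψ s) ^ 2))) •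
          ((H (ψ s) * k₁ (ψ s) * (ρ (ψ s) - H (ψ s))) • Tt (ψ s)
            - (κt (ψ s) ^ 2 * (1 + H (ψ s) ^ 2) ^ 2) • Nt (ψ s)
            - (k₁ (ψ s) * (H (ψ s) - ρ (ψ s))) • Bt (ψ s)))
        -- `B_n`
        (fun s => (1 / √(Δ (ψ s))) •
          ((κt (ψ s) ^ 2 * H (ψ s) * (1 + H (ψ s) ^ 2)) • Tt (ψ s)
            + (k₁ (ψ s) * (ρ (ψ s) - H (ψ s))) • Nt (ψ s)
            + (κt (ψ s) ^ 2 * (1 + H (ψ s) ^ 2)) • Bt (ψ s)))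
        -- `κ_n`
        (fun s => √(Δ (ψ s)) / (κt (ψ s) ^ 2 * (1 + H (ψ s) ^ 2) ^ (3 / 2 : ℝ)))
        -- `(τ - τ_G)_n`
        (fun s => ε * (H (ψ s) - ρ (ψ s)) *
          ((3 * k₁ (ψ s) ^ 2 - k₂ (ψ s) * κt (ψ s)) * (1 + H (ψ s) ^ 2)
            - 3 * k₁ (ψ s) ^ 2 * H (ψ s) * (H (ψ s) - ρ (ψ s))) / Δ (ψ s)) := by
  obtain ⟨A, At, hA, hAt, hline, hne⟩ := hpair.normal_lines
  obtain ⟨ε, hε, hN, hρH, h⟩ := exists_hasFrenetApparatus_indicatrix (E := EuclideanSpace ℝ (Fin 3))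
    m.form_symm (o := o) hIopen hIconn hJopen (hα.isFrenetCurve hIopen)
    (hαt.isFrenetCurve hJopen) (fun t ht => (hαt.frame t ht).isOrientedFrame)
    hαt.curvature_pos hαt.smooth_κ hpair.bijOn hpair.differentiable hpair.deriv_pos
    (A := A) (At := At) (fun s hs => (hα.velocity s hs).symm ▸ hA s hs)
    (fun t ht => (hαt.velocity t ht).symm ▸ hAt t ht) hline hne hκt hH hρ hH0 hk₁ hk₂ hΔ
  refine ⟨ε, hε, hN, hρH, fun s₀ hs₀ => ?_⟩
  have h0 := h s₀ hs₀
  exact ⟨h0.differentiable, h0.regular, h0.arcLength,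
    fun s hs => (h0.frame s hs).isPositiveFrame, h0.curvature_pos, h0.tangent, h0.frenet_T,
    h0.frenet_N, h0.frenet_B⟩
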